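/- **Theorem.** Let $p\neq q$ be prime numbers and let $\Delta\subset\mathbb R^d$ be a $d$-dimensional lattice simplex, with vertices $v_0,\dots,v_d\in\mathbb Z^d$, of normalized volume $d!\,\mathrm{vol}(\Delta)=pq$. Put $$\Lambda_\Delta=\Big\{(\lambda_0,\dots,\lambda_d)\in(\mathbb R/\mathbb Z)^{d+1} : \sum_{i=0}^d\lambda_i(v_i,1)\in\mathbb Z^{d+1}\Big\}.$$ Suppose that $\Delta$ is not a lattice pyramid over a lower-dimensional lattice simplex, that is, $\Delta$ is not the image, under a map $x\mapsto xU+w$ with $U\in\mathbb Z^{d\times d}$, $\det U=\pm1$, $w\in\mathbb Z^d$, of $\mathrm{conv}\big((\Delta'\times\{0\})\cup\{(0,\dots,0,1)\}\big)$ for a $(d-1)$-dimensional lattice simplex $\Delta'\subset\mathbb R^{d-1}$. Let $r$ be a positive integer. Then $\Delta$ is Gorenstein of index $r$ if and only if there exist nonnegative integers $s_1,s_2,s_3$ with $s_1+s_2+s_3=d+1$ such that both of the following hold: 1. $rpq=s_1q+s_2p+s_3$; 2. for some ordering of the vertices of $\Delta$, the group $\Lambda_\Delta$ is generated by $$\Big(\underbrace{\tfrac1p,\dots,\tfrac1p}_{s_1},\underbrace{\tfrac1q,\dots,\tfrac1q}_{s_2},\underbrace{\tfrac1{pq},\dots,\tfrac1{pq}}_{s_3}\Big).$$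 Here a lattice polytope $P\subset\mathbb R^d$ is *Gorenstein of index $r$* if there is $w\in\mathbb Z^d$ such that $Q=rP+w$ is *reflexive*: $Q$ is a lattice polytope, the origin is the unique lattice point in the interior of $Q$, and the dual $\{y\in\mathbb R^d:\langle x,y\rangle\le 1\text{ for all }x\in Q\}$ is also a lattice polytope. -/

import Mathlib

open scoped Nat

namespace GorensteinSimplex

/-- The inclusion of the lattice `ℤ^d` into `ℝ^d`. -/
def toReal {d : ℕ} (z : Fin d → ℤ) : Fin d → ℝ := fun j => (z j : ℝ)

/-- A lattice polytope in `ℝ^d`: the convex hull of finitely many lattice points. -/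
def IsLatticePolytope {d : ℕ} (P : Set (Fin d → ℝ)) : Prop :=
  ∃ S : Finset (Fin d → ℤ), P = convexHull ℝ (toReal '' (S : Set (Fin d → ℤ)))

/-- The polytope spanned by the lattice points `v 0, …, v n`. -/
def hull {d n : ℕ} (v : Fin (n + 1) → Fin d → ℤ) : Set (Fin d → ℝ) :=
  convexHull ℝ (Set.range fun i => toReal (v i))

/-- The lattice points `v 0, …, v d` of `ℝ^d` are the vertices of a `d`-dimensional simplex. -/
def IsSimplex {d : ℕ} (v : Fin (d + 1) → Fin d → ℤ) : Prop :=
  AffineIndependent ℝ fun i => toReal (v i)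

/-- The normalized volume: `d!` times the Lebesgue measure on `ℝ^d`. -/
noncomputable def normalizedVolume {d : ℕ} (P : Set (Fin d → ℝ)) : ℝ :=
  (d ! : ℝ) * MeasureTheory.volume.real P

/-- Unimodular equivalence: `Q = f_U(P) + w`, where `f_U(x) = x U` for row vectors `x`,
`U` is an integral matrix of determinant `±1` and `w` is an integral vector. -/
def UnimodularlyEquivalent {d : ℕ} (P Q : Set (Fin d → ℝ)) : Prop :=
  ∃ (U : Matrix (Fin d) (Fin d) ℤ) (w : Fin d → ℤ), (U.det = 1 ∨ U.det = -1) ∧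
    Q = (fun x => Matrix.vecMul x (U.map fun a : ℤ => (a : ℝ)) + toReal w) '' P

/-- `Pyr(P) = conv(P × {0}, (0, …, 0, 1))` in `ℝ^(e+1)`. -/
def pyramid {e : ℕ} (P : Set (Fin e → ℝ)) : Set (Fin (e + 1) → ℝ) :=
  convexHull ℝ (insert (Pi.single (Fin.last e) 1)
    ((fun x : Fin e → ℝ => (Fin.snoc x 0 : Fin (e + 1) → ℝ)) '' P))

/-- `P ⊆ ℝ^d` is, up to unimodular equivalence, the lattice pyramid over a lattice simplex of
dimension `d - 1` in `ℝ^(d-1)`. (A polytope obtained from a simplex of still lower dimension by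
repeatedly taking pyramids is of this form.) -/
def IsLatticePyramid : {d : ℕ} → Set (Fin d → ℝ) → Prop
  | 0, _ => False
  | e + 1, P => ∃ u : Fin (e + 1) → Fin e → ℤ, IsSimplex u ∧
      UnimodularlyEquivalent (pyramid (hull u)) P

/-- The dual `{y | ⟨x, y⟩ ≤ 1 for all x ∈ P}`, for the usual inner product of `ℝ^d`. -/
def dual {d : ℕ} (P : Set (Fin d → ℝ)) : Set (Fin d → ℝ) :=
  {y | ∀ x ∈ P, x ⬝ᵥ y ≤ 1}

/-- A lattice polytope is reflexive if the origin is the unique lattice point in its interior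
and its dual is a lattice polytope too. -/
def IsReflexive {d : ℕ} (P : Set (Fin d → ℝ)) : Prop :=
  IsLatticePolytope P ∧ (∀ z : Fin d → ℤ, toReal z ∈ interior P ↔ z = 0) ∧
    IsLatticePolytope (dual P)

/-- A lattice polytope `P` is Gorenstein of index `r > 0` if `r P + w` is reflexive for some
lattice point `w`. -/
def IsGorenstein {d : ℕ} (P : Set (Fin d → ℝ)) (r : ℕ) : Prop :=
  IsLatticePolytope P ∧ 0 < r ∧
    ∃ w : Fin d → ℤ, IsReflexive ((fun x => (r : ℝ) • x + toReal w) '' P)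

/-- The group `Λ` of all `(λ_0, …, λ_d) ∈ (ℝ/ℤ)^(d+1)` with `∑ λ_i (v_i, 1) ∈ ℤ^(d+1)`.
That a linear combination with integral coefficients is an integer is expressed as its being
zero in `ℝ/ℤ`; see `coe_mem_latticeGroup` for the form with real representatives. -/
def latticeGroup {d n : ℕ} (v : Fin (n + 1) → Fin d → ℤ) :
    AddSubgroup (Fin (n + 1) → UnitAddCircle) where
  carrier := {l | (∀ j, ∑ i, v i j • l i = 0) ∧ ∑ i, l i = 0}
  zero_mem' := by simp
  add_mem' := by
    rintro a b ⟨ha, ha'⟩ ⟨hb, hb'⟩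
    refine ⟨fun j => ?_, ?_⟩
    · simp [smul_add, Finset.sum_add_distrib, ha j, hb j]
    · simp [Finset.sum_add_distrib, ha', hb']
  neg_mem' := by
    rintro a ⟨ha, ha'⟩
    refine ⟨fun j => ?_, ?_⟩
    · simp [smul_neg, Finset.sum_neg_distrib, ha j]
    · simp [Finset.sum_neg_distrib, ha']

theorem coe_mem_latticeGroup {d n : ℕ} (v : Fin (n + 1) → Fin d → ℤ) (x : Fin (n + 1) → ℝ) :
    (fun i => (x i : UnitAddCircle)) ∈ latticeGroup v ↔
      (∃ z : Fin d → ℤ, ∑ i, x i • toReal (v i) = toReal z) ∧ ∃ m : ℤ, ∑ i, x i = (m : ℝ) := by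
  have key : ∀ y : Fin (n + 1) → ℝ,
      ∑ i, (y i : UnitAddCircle) = 0 ↔ ∃ m : ℤ, ∑ i, y i = (m : ℝ) := by
    intro y
    have h : ∑ i, (y i : UnitAddCircle) = ((∑ i, y i : ℝ) : UnitAddCircle) :=
      (map_sum (QuotientAddGroup.mk' (AddSubgroup.zmultiples (1 : ℝ))) y Finset.univ).symm
    rw [h, AddCircle.coe_eq_zero_iff]
    simp only [zsmul_eq_mul, mul_one, eq_comm]
  change ((∀ j, ∑ i, v i j • (x i : UnitAddCircle) = 0) ∧ ∑ i, (x i : UnitAddCircle) = 0) ↔ _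
  rw [key x]
  refine and_congr_left fun _ => ?_
  have h2 : ∀ j, (∑ i, v i j • (x i : UnitAddCircle) = 0) ↔
      ∃ m : ℤ, ∑ i, x i * (v i j : ℝ) = (m : ℝ) := by
    intro j
    rw [← key]
    have h3 : ∀ i, v i j • (x i : UnitAddCircle) = ((x i * (v i j : ℝ) : ℝ) : UnitAddCircle) := by
      intro i
      rw [← AddCircle.coe_zsmul, zsmul_eq_mul, mul_comm]
    simp only [h3]
  simp only [h2]
  constructor
  · intro h
    choose z hz using h
    refine ⟨z, funext fun j => ?_⟩
    simpa [toReal, Finset.sum_apply] using hz j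
  · rintro ⟨z, hz⟩ j
    refine ⟨z j, ?_⟩
    simpa [toReal, Finset.sum_apply] using congrFun hz j

/-- The element of `(ℝ/ℤ)^(n+1)` whose first `s₁` entries are `1/p`, whose next `s₂` entries are
`1/q`, and whose remaining entries are `1/(pq)`. -/
noncomputable def generator (n p q s₁ s₂ : ℕ) : Fin (n + 1) → UnitAddCircle := fun i =>
  if (i : ℕ) < s₁ then ((1 / (p : ℝ) : ℝ) : UnitAddCircle)
  else if (i : ℕ) < s₁ + s₂ then ((1 / (q : ℝ) : ℝ) : UnitAddCircle)
  else ((1 / ((p : ℝ) * (q : ℝ)) : ℝ) : UnitAddCircle)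

end GorensteinSimplex

open GorensteinSimplex

/-!
Everything is read off from the barycentric coordinates `β i` of the simplex.

* The order of `latticeGroup v` is the normalized volume (`normalizedVolume_hull`,
  `card_latticeGroup`): sending a lattice point to the linear parts of its barycentric coordinates
  modulo `1` maps `ℤ^d` onto the group, with kernel the lattice spanned by the edges at `v 0`; the
  index of that lattice and the volume of the simplex are both given by the determinant of the
  edges.
* A simplex is reflexive exactly if there are lattice vectors `y i` and integers `m i > 0` with
  `1 - y i ⬝ᵥ x = m i * β i x` (`isReflexive_of_facetNormal`,
  `exists_facetNormal_of_isReflexive`): the `y i` are the vertices of the dual.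
* Hence (`isGorenstein_of_reciprocal_mem`, `reciprocal_mem_of_isGorenstein`) a simplex is Gorenstein
  of index `r` exactly if there are positive integers `c i` such that `(1 / c i)` lies in
  `latticeGroup v`, `∑ i, 1 / c i = r`, and `c i` annihilates the `i`-th coordinate of every element
  of the group. Here the dilated simplex `r P + w` has `m i = r * c i`.
* If the `i`-th coordinate vanishes on the whole group, then the simplex is a lattice pyramid with
  apex `v i` (`isLatticePyramid_of_coordinate_eq_zero`).

For a group of order `p * q` each `c i` divides `p * q`, and it is not `1` as the simplex is no
pyramid, so it is `p`, `q` or `p * q`. The order of `(1 / c i)` annihilates the group, hence is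
divisible by `p` and by `q`, so this element generates (`eq_zmultiples_of_reciprocal_mem`), and
`s₁`, `s₂`, `s₃` count the `i` with each value of `c i`. Conversely a generator of the given form
has the properties required of `(1 / c i)`.
-/

open scoped Nat

namespace GorensteinSimplex

/-! ### The volume of a lattice simplex -/

open MeasureTheory

/-- The corner simplex of size `t`: the points of the nonnegative orthant whose coordinates
sum to at most `t`. -/
def cornerSimplex (n : ℕ) (t : ℝ) : Set (Fin n → ℝ) :=
  {x | (∀ i, 0 ≤ x i) ∧ ∑ i, x i ≤ t}

theorem isClosed_cornerSimplex (n : ℕ) (t : ℝ) : IsClosed (cornerSimplex n t) := by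
  have h : cornerSimplex n t = (⋂ i, {x | 0 ≤ x i}) ∩ {x | ∑ i, x i ≤ t} := by
    ext x; simp [cornerSimplex]
  rw [h]
  exact (isClosed_iInter fun i => isClosed_le continuous_const (continuous_apply i)).inter
    (isClosed_le (by fun_prop) continuous_const)

/-- The volume `t ^ n / n !`, by integrating over the slices with fixed first coordinate `s`, which
are corner simplices of size `t - s`. -/
theorem volume_cornerSimplex (n : ℕ) {t : ℝ} (ht : 0 ≤ t) :
    volume (cornerSimplex n t) = ENNReal.ofReal (t ^ n / n !) := by
  induction n generalizing t with
  | zero =>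
    have h : cornerSimplex 0 t = Set.univ := by
      ext x; simp [cornerSimplex, ht]
    rw [h]
    simp [volume_pi]
  | succ n ih =>
    have hmp := (volume_preserving_piFinSuccAbove (fun _ : Fin (n + 1) => ℝ) 0).symm
    rw [← hmp.measure_preimage (isClosed_cornerSimplex _ _).measurableSet.nullMeasurableSet,
      Measure.volume_eq_prod, Measure.prod_apply
        (hmp.measurable (isClosed_cornerSimplex _ _).measurableSet)]
    have hslice : ∀ s : ℝ, volume (Prod.mk s ⁻¹'
        ((MeasurableEquiv.piFinSuccAbove (fun _ : Fin (n + 1) => ℝ) 0).symm ⁻¹'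
          cornerSimplex (n + 1) t)) =
        (Set.Icc 0 t).indicator (fun s => ENNReal.ofReal ((t - s) ^ n / n !)) s := by
      intro s
      by_cases hs : s ∈ Set.Icc 0 t
      · rw [Set.indicator_of_mem hs, ← ih (sub_nonneg.2 hs.2)]
        congr 1
        ext y
        simp [cornerSimplex, Fin.forall_fin_succ, Fin.sum_univ_succ, hs.1, le_sub_iff_add_le',
          MeasurableEquiv.piFinSuccAbove]
      · rw [Set.indicator_of_notMem hs]
        convert measure_empty (μ := (volume : Measure (Fin n → ℝ)))
        ext y
        simp only [cornerSimplex, Set.mem_preimage, Set.mem_ofPred_eq, Set.mem_empty_iff_false,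
          iff_false]
        rintro ⟨h1, h2⟩
        refine hs ⟨by simpa [MeasurableEquiv.piFinSuccAbove] using h1 0, ?_⟩
        refine le_trans ?_ h2
        simpa [MeasurableEquiv.piFinSuccAbove] using
          Finset.single_le_sum (fun i _ => h1 i) (Finset.mem_univ 0)
    rw [lintegral_congr hslice, lintegral_indicator measurableSet_Icc,
      ← ofReal_integral_eq_lintegral_ofReal]
    · congr 1
      rw [integral_Icc_eq_integral_Ioc, ← intervalIntegral.integral_of_le ht]
      simp only [intervalIntegral.integral_div]
      rw [intervalIntegral.integral_comp_sub_left (fun x => x ^ n) t]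
      simp only [sub_self, sub_zero, integral_pow, Nat.factorial_succ]
      push_cast
      field_simp
      simp
    · exact ContinuousOn.integrableOn_Icc (by fun_prop)
    · filter_upwards [ae_restrict_mem measurableSet_Icc] with s hs
      have := sub_nonneg.2 hs.2
      positivity

theorem mem_convexHull_range_iff {ι E : Type*} [Fintype ι] [AddCommGroup E] [Module ℝ E]
    {u : ι → E} {y : E} :
    y ∈ convexHull ℝ (Set.range u) ↔ ∃ w ∈ stdSimplex ℝ ι, ∑ i, w i • u i = y := by
  classical
  have h : Set.range u = Fintype.linearCombination ℝ u '' Set.range fun i => Pi.single i 1 := by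
    rw [← Set.range_comp]
    congr 1
    ext i
    simp
  rw [h, ← LinearMap.image_convexHull, convexHull_rangle_single_eq_stdSimplex]
  simp [Fintype.linearCombination_apply]

/-- The edge vectors `v (i + 1) - v 0` of a simplex, as the rows of a matrix. -/
def edges {d : ℕ} (v : Fin (d + 1) → Fin d → ℤ) : Matrix (Fin d) (Fin d) ℤ :=
  Matrix.of fun i j => v i.succ j - v 0 j

theorem hull_eq_image_cornerSimplex {d : ℕ} (v : Fin (d + 1) → Fin d → ℤ) :
    hull v = (fun x => x + toReal (v 0)) ''
      (Matrix.toLin' ((edges v).map fun a : ℤ => (a : ℝ)).transpose '' cornerSimplex d 1) := by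
  rw [hull, Set.image_image]
  have hE : ∀ x : Fin d → ℝ,
      Matrix.toLin' ((edges v).map fun a : ℤ => (a : ℝ)).transpose x + toReal (v 0) =
        (1 - ∑ i, x i) • toReal (v 0) + ∑ i, x i • toReal (v (Fin.succ i)) := by
    intro x
    ext j
    simp only [Matrix.toLin'_apply, Pi.add_apply, Matrix.mulVec, dotProduct, edges, toReal,
      Matrix.transpose_apply, Matrix.map_apply, Matrix.of_apply, Pi.smul_apply, smul_eq_mul,
      Finset.sum_apply]
    push_cast
    simp only [sub_mul, Finset.sum_sub_distrib, ← Finset.mul_sum]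
    simp only [mul_comm]
    ring
  simp only [hE]
  ext y
  rw [mem_convexHull_range_iff, Set.mem_image]
  constructor
  · rintro ⟨w, ⟨hw0, hw1⟩, rfl⟩
    rw [Fin.sum_univ_succ] at hw1
    refine ⟨fun i => w i.succ, ⟨fun i => hw0 _, by linarith [hw0 0]⟩, ?_⟩
    rw [Fin.sum_univ_succ, ← hw1, add_sub_cancel_right]
  · rintro ⟨x, ⟨hx0, hx1⟩, rfl⟩
    refine ⟨Fin.cons (1 - ∑ i, x i) x, ⟨Fin.cases (by simpa using hx1) (by simpa using hx0), ?_⟩, ?_⟩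
    · simp [Fin.sum_univ_succ]
    · simp [Fin.sum_univ_succ]

theorem normalizedVolume_hull {d : ℕ} (v : Fin (d + 1) → Fin d → ℤ) :
    normalizedVolume (hull v) = ((edges v).det.natAbs : ℝ) := by
  rw [normalizedVolume, hull_eq_image_cornerSimplex, measureReal_def, Set.image_add_right,
    measure_preimage_add_right, Measure.addHaar_image_linearMap, LinearMap.det_toLin',
    Matrix.det_transpose, volume_cornerSimplex d zero_le_one, ENNReal.toReal_mul,
    ENNReal.toReal_ofReal (abs_nonneg _), ENNReal.toReal_ofReal (by positivity), one_pow,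
    Nat.cast_natAbs]
  have h : ((edges v).map fun a : ℤ => (a : ℝ)).det = ((edges v).det : ℝ) :=
    (Int.cast_det (R := ℝ) (edges v)).symm
  rw [h]
  have := Nat.factorial_ne_zero d
  push_cast
  field_simp

/-! ### Barycentric coordinates and the order of the lattice group -/

/-- The vertices of a full-dimensional simplex as an affine basis, giving access to the
barycentric coordinates `(baryBasis hu).coord i`. -/
noncomputable def baryBasis {d : ℕ} {u : Fin (d + 1) → Fin d → ℝ} (hu : AffineIndependent ℝ u) :
    AffineBasis (Fin (d + 1)) ℝ (Fin d → ℝ) :=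
  ⟨u, hu, hu.affineSpan_eq_top_iff_card_eq_finrank_add_one.2 (by simp)⟩

/-- The linear part of the `i`-th barycentric coordinate. -/
noncomputable def baryLinear {d : ℕ} {u : Fin (d + 1) → Fin d → ℝ} (hu : AffineIndependent ℝ u)
    (i : Fin (d + 1)) : (Fin d → ℝ) →ₗ[ℝ] ℝ :=
  ((baryBasis hu).coord i).linear

section

variable {d : ℕ} {u : Fin (d + 1) → Fin d → ℝ} (hu : AffineIndependent ℝ u)

theorem baryLinear_sub (i : Fin (d + 1)) (x y : Fin d → ℝ) :
    baryLinear hu i (x - y) = (baryBasis hu).coord i x - (baryBasis hu).coord i y :=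
  ((baryBasis hu).coord i).linearMap_vsub x y

theorem coord_apply_vertex (i j : Fin (d + 1)) :
    (baryBasis hu).coord i (u j) = if i = j then 1 else 0 :=
  (baryBasis hu).coord_apply i j

theorem sum_baryLinear (x : Fin d → ℝ) : ∑ i, baryLinear hu i x = 0 := by
  have h := fun y => (baryBasis hu).sum_coord_apply_eq_one y
  rw [← sub_zero x]
  simp only [baryLinear_sub, Finset.sum_sub_distrib, h, sub_self]

theorem sum_coord_smul (x : Fin d → ℝ) : ∑ i, (baryBasis hu).coord i x • u i = x :=
  (baryBasis hu).linear_combination_coord_eq_self x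

theorem sum_baryLinear_smul (x : Fin d → ℝ) : ∑ i, baryLinear hu i x • u i = x := by
  conv_rhs => rw [← sub_zero x, ← sum_coord_smul hu x, ← sum_coord_smul hu 0,
    ← Finset.sum_sub_distrib]
  refine Finset.sum_congr rfl fun i _ => ?_
  rw [← sub_smul, ← baryLinear_sub, sub_zero]

theorem coord_sum_smul (i : Fin (d + 1)) {w : Fin (d + 1) → ℝ} (hw : ∑ j, w j = 1) :
    (baryBasis hu).coord i (∑ j, w j • u j) = w i := by
  have := (baryBasis hu).coord_apply_combination_of_mem (Finset.mem_univ i) hw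
  rwa [Finset.affineCombination_eq_linear_combination _ _ _ hw] at this

theorem baryLinear_sum_smul (i : Fin (d + 1)) {w : Fin (d + 1) → ℝ} (hw : ∑ j, w j = 0) :
    baryLinear hu i (∑ j, w j • u j) = w i := by
  have h : ∑ j, w j • u j = ∑ j, (w j + if j = 0 then 1 else 0) • u j - u 0 := by
    simp [add_smul, Finset.sum_add_distrib]
  rw [h, baryLinear_sub, coord_sum_smul hu i (by simp [Finset.sum_add_distrib, hw]),
    coord_apply_vertex, add_sub_cancel_right]

end

section

variable {d : ℕ}

theorem toReal_add (x y : Fin d → ℤ) : toReal (x + y) = toReal x + toReal y := by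
  ext; simp [toReal]

theorem toReal_sub (x y : Fin d → ℤ) : toReal (x - y) = toReal x - toReal y := by
  ext; simp [toReal]

theorem toReal_zsmul (c : ℤ) (x : Fin d → ℤ) : toReal (c • x) = (c : ℝ) • toReal x := by
  ext; simp [toReal]

theorem toReal_zero : toReal (0 : Fin d → ℤ) = 0 := by
  ext; simp [toReal]

theorem toReal_injective : Function.Injective (toReal : (Fin d → ℤ) → Fin d → ℝ) :=
  fun x y h => funext fun j => by simpa [toReal] using congrFun h j

theorem toReal_sum {ι : Type*} (s : Finset ι) (f : ι → Fin d → ℤ) :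
    toReal (∑ i ∈ s, f i) = ∑ i ∈ s, toReal (f i) := by
  ext; simp [toReal]

theorem exists_intCast_of_coe_eq_zero {x : ℝ} (h : (x : UnitAddCircle) = 0) :
    ∃ m : ℤ, x = m := by
  obtain ⟨m, hm⟩ := (AddCircle.coe_eq_zero_iff 1).1 h
  exact ⟨m, by simpa using hm.symm⟩

theorem coe_intCast (m : ℤ) : ((m : ℝ) : UnitAddCircle) = 0 :=
  (AddCircle.coe_eq_zero_iff 1).2 ⟨m, by simp⟩

variable {v : Fin (d + 1) → Fin d → ℤ} (hv : AffineIndependent ℝ fun i => toReal (v i))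

/-- The map `ℤ^d → (ℝ/ℤ)^(d+1)` sending a lattice point to the linear parts of its barycentric
coordinates, modulo `1`. -/
noncomputable def baryHom : (Fin d → ℤ) →+ (Fin (d + 1) → UnitAddCircle) where
  toFun z := fun i => (baryLinear hv i (toReal z) : UnitAddCircle)
  map_zero' := by ext i; simp [toReal_zero]
  map_add' x y := by ext i; simp [toReal_add]

theorem baryHom_mem (z : Fin d → ℤ) : baryHom hv z ∈ latticeGroup v :=
  (coe_mem_latticeGroup v fun i => baryLinear hv i (toReal z)).2
    ⟨⟨z, sum_baryLinear_smul hv _⟩, 0, by rw [sum_baryLinear, Int.cast_zero]⟩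

/-- Every element of the lattice group comes from a lattice point: if `∑ x i = m`, lowering `x 0` by
`m` makes the coefficients sum to zero without changing them modulo `1`. -/
theorem range_baryHom : (baryHom hv).range = latticeGroup v := by
  ext l
  constructor
  · rintro ⟨z, rfl⟩
    exact baryHom_mem hv z
  · intro hl
    choose x hx using fun i => QuotientAddGroup.mk_surjective (l i)
    obtain rfl : (fun i => (x i : UnitAddCircle)) = l := funext hx
    obtain ⟨⟨z, hz⟩, m, hm⟩ := (coe_mem_latticeGroup v x).1 hl
    refine ⟨z - m • v 0, funext fun i => ?_⟩
    have h : toReal (z - m • v 0) =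
        ∑ j, (x j - if j = 0 then (m : ℝ) else 0) • toReal (v j) := by
      rw [toReal_sub, toReal_zsmul, ← hz]
      simp [sub_smul, Finset.sum_sub_distrib]
    change ((baryLinear hv i (toReal (z - m • v 0)) : ℝ) : UnitAddCircle) = _
    rw [h, baryLinear_sum_smul hv i (by simp [Finset.sum_sub_distrib, hm]), AddCircle.coe_sub]
    split_ifs <;> simp [coe_intCast]

theorem toReal_edges (i : Fin d) :
    toReal (edges v i) =
      ∑ j, ((if j = i.succ then 1 else 0) - if j = 0 then 1 else 0 : ℝ) • toReal (v j) := by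
  have : edges v i = v i.succ - v 0 := rfl
  rw [this, toReal_sub]
  simp [sub_smul, Finset.sum_sub_distrib]

theorem baryLinear_edges (i : Fin (d + 1)) (j : Fin d) :
    baryLinear hv i (toReal (edges v j)) =
      (if i = j.succ then 1 else 0) - if i = 0 then 1 else 0 := by
  rw [toReal_edges, baryLinear_sum_smul hv i (by simp [Finset.sum_sub_distrib])]

theorem linearIndependent_edges (hv : AffineIndependent ℝ fun i => toReal (v i)) :
    LinearIndependent ℤ (fun i => edges v i) := by
  rw [Fintype.linearIndependent_iff]
  intro c hc i
  have h := congrArg (fun z => baryLinear hv i.succ (toReal z)) hc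
  simp only [toReal_sum, toReal_zsmul, toReal_zero, map_sum, map_smul, map_zero,
    baryLinear_edges hv] at h
  simpa using h

theorem ker_baryHom :
    (baryHom hv).ker = (Submodule.span ℤ (Set.range fun i => edges v i)).toAddSubgroup := by
  ext z
  simp only [AddMonoidHom.mem_ker, Submodule.mem_toAddSubgroup]
  constructor
  · intro hz
    choose m hm using fun i => exists_intCast_of_coe_eq_zero (congrFun hz i)
    have h : z = ∑ j : Fin d, m j.succ • edges v j := by
      apply toReal_injective
      have h0 := sum_baryLinear hv (toReal z)
      have h1 := sum_baryLinear_smul hv (toReal z)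
      simp only [hm, Fin.sum_univ_succ] at h0 h1
      rw [← h1, toReal_sum, eq_neg_of_add_eq_zero_left h0]
      have h2 : ∀ j : Fin d, edges v j = v j.succ - v 0 := fun j => rfl
      simp only [h2, toReal_zsmul, toReal_sub, smul_sub, Finset.sum_sub_distrib, ← Finset.sum_smul,
        neg_smul]
      abel
    rw [h]
    exact Submodule.sum_mem _ fun j _ =>
      Submodule.smul_mem _ _ (Submodule.subset_span ⟨j, rfl⟩)
  · intro hz
    refine (Submodule.span_le (p := (AddMonoidHom.toIntLinearMap (baryHom hv)).ker)).2 ?_ hz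
    rintro _ ⟨j, rfl⟩
    ext i
    change ((baryLinear hv i (toReal (edges v j)) : ℝ) : UnitAddCircle) = 0
    rw [baryLinear_edges]
    split_ifs <;> simp

/-- The lattice group is the quotient of `ℤ^d` by the lattice of the edges. -/
theorem card_latticeGroup (hv : AffineIndependent ℝ fun i => toReal (v i)) :
    Nat.card (latticeGroup v) = (edges v).det.natAbs := by
  let b := Module.Basis.span (linearIndependent_edges hv)
  have h := Submodule.natAbs_det_basis_change (Pi.basisFun ℤ (Fin d)) _ b
  have hb : (fun i => ((b i : _) : Fin d → ℤ)) = fun i => edges v i := by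
    ext1 i
    exact congrArg Subtype.val (Module.Basis.span_apply (linearIndependent_edges hv) i)
  rw [← range_baryHom hv, ← AddSubgroup.index_ker, ker_baryHom hv]
  rw [show (Subtype.val ∘ b) = fun i => edges v i from hb, Pi.basisFun_det_apply] at h
  exact h.symm

end

/-! ### Reflexive simplices -/

theorem hull_isLatticePolytope {d n : ℕ} (v : Fin (n + 1) → Fin d → ℤ) :
    IsLatticePolytope (hull v) := by
  refine ⟨Finset.univ.image v, ?_⟩
  rw [Finset.coe_image, Finset.coe_univ, Set.image_univ, ← Set.range_comp]
  rfl

section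

variable {d : ℕ} {u : Fin (d + 1) → Fin d → ℝ} (hu : AffineIndependent ℝ u)

theorem dotProduct_baryLinear_single (i : Fin (d + 1)) (x : Fin d → ℝ) :
    (fun j => baryLinear hu i (Pi.single j 1)) ⬝ᵥ x = baryLinear hu i x := by
  conv_rhs => rw [← Finset.univ_sum_single x, map_sum]
  refine Finset.sum_congr rfl fun j _ => ?_
  rw [mul_comm, ← smul_eq_mul, ← map_smul, ← Pi.single_smul, smul_eq_mul, mul_one]

theorem eq_of_dotProduct_vertex_eq (hu : AffineIndependent ℝ u) {a b : Fin d → ℝ}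
    (h : ∀ j, a ⬝ᵥ u j = b ⬝ᵥ u j) : a = b := by
  refine dotProduct_eq _ _ fun x => ?_
  rw [← sum_baryLinear_smul hu x]
  simp only [dotProduct_sum, dotProduct_smul, h]

theorem sum_coord_zero_mul_dotProduct (a : Fin d → ℝ) :
    ∑ j, (baryBasis hu).coord j 0 * (a ⬝ᵥ u j) = 0 := by
  conv_rhs => rw [← dotProduct_zero a, ← sum_coord_smul hu 0]
  simp only [dotProduct_sum, dotProduct_smul, smul_eq_mul]

theorem mul_coord_of_dotProduct {i : Fin (d + 1)} {y : Fin d → ℝ} {m : ℝ}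
    (h : ∀ j, y ⬝ᵥ u j = 1 - if i = j then m else 0) (x : Fin d → ℝ) :
    m * (baryBasis hu).coord i x = 1 - y ⬝ᵥ x := by
  have hx : y ⬝ᵥ x = ∑ j, (baryBasis hu).coord j x * (1 - if i = j then m else 0) := by
    conv_lhs => rw [← sum_coord_smul hu x]
    simp only [dotProduct_sum, dotProduct_smul, h, smul_eq_mul]
  rw [hx]
  simp only [mul_sub, mul_one, Finset.sum_sub_distrib, (baryBasis hu).sum_coord_apply_eq_one]
  simp [mul_comm]

theorem interior_convexHull_range :
    interior (convexHull ℝ (Set.range u)) = {x | ∀ i, 0 < (baryBasis hu).coord i x} :=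
  (baryBasis hu).interior_convexHull

end

theorem mem_dual_convexHull_range {ι : Type*} [Fintype ι] {d : ℕ} {u : ι → Fin d → ℝ}
    {y : Fin d → ℝ} : y ∈ dual (convexHull ℝ (Set.range u)) ↔ ∀ i, y ⬝ᵥ u i ≤ 1 := by
  constructor
  · intro h i
    rw [dotProduct_comm]
    exact h _ (subset_convexHull ℝ _ ⟨i, rfl⟩)
  · intro h x hx
    obtain ⟨w, ⟨hw0, hw1⟩, rfl⟩ := mem_convexHull_range_iff.1 hx
    rw [dotProduct_comm, ← hw1, dotProduct_sum]
    refine Finset.sum_le_sum fun i _ => ?_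
    rw [dotProduct_smul, smul_eq_mul]
    exact mul_le_of_le_one_right (hw0 i) (h i)

theorem toReal_dotProduct {d : ℕ} (x y : Fin d → ℤ) :
    toReal x ⬝ᵥ toReal y = ((x ⬝ᵥ y : ℤ) : ℝ) := by
  simp [dotProduct, toReal]

section

variable {d : ℕ} {u : Fin (d + 1) → Fin d → ℤ}

/-- The hypothesis on `y` says that `1 - y i ⬝ᵥ x` is `m i` times the `i`-th barycentric coordinate,
as both are affine and agree on the vertices. -/
theorem mul_coord_of_facetNormal (hu : AffineIndependent ℝ fun i => toReal (u i))
    {m : Fin (d + 1) → ℤ} {y : Fin (d + 1) → Fin d → ℤ}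
    (h : ∀ i j, y i ⬝ᵥ u j = 1 - if i = j then m i else 0) (i : Fin (d + 1)) (x : Fin d → ℝ) :
    (m i : ℝ) * (baryBasis hu).coord i x = 1 - toReal (y i) ⬝ᵥ x := by
  refine mul_coord_of_dotProduct hu (fun j => ?_) x
  rw [toReal_dotProduct, h]
  push_cast
  rfl

/-- Such `y i` are the vertices of the dual: `x` in the dual is the combination of the `y i` with
weights `β i 0 * (1 - x ⬝ᵥ u i)`. -/
theorem isReflexive_of_facetNormal (hu : AffineIndependent ℝ fun i => toReal (u i))
    {m : Fin (d + 1) → ℤ} {y : Fin (d + 1) → Fin d → ℤ} (hm : ∀ i, 0 < m i)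
    (h : ∀ i j, y i ⬝ᵥ u j = 1 - if i = j then m i else 0) : IsReflexive (hull u) := by
  have hm' : ∀ i, (0 : ℝ) < m i := fun i => Int.cast_pos.2 (hm i)
  have key := mul_coord_of_facetNormal hu h
  have hβ0 : ∀ i, (m i : ℝ) * (baryBasis hu).coord i 0 = 1 := fun i => by
    rw [key, dotProduct_zero, sub_zero]
  refine ⟨hull_isLatticePolytope u, fun z => ?_, ?_⟩
  · rw [hull, interior_convexHull_range hu, Set.mem_ofPred_eq]
    constructor
    · intro hz
      -- On lattice points `m i` times the `i`-th coordinate is an integer, so a positive value is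
      -- at least the value at the origin; the coordinates summing to one forces equality.
      have hle : ∀ i, (baryBasis hu).coord i 0 ≤ (baryBasis hu).coord i (toReal z) := by
        intro i
        refine le_of_mul_le_mul_left ?_ (hm' i)
        have hpos := mul_pos (hm' i) (hz i)
        rw [key, toReal_dotProduct] at hpos
        rw [hβ0, key, toReal_dotProduct]
        have : (0 : ℤ) < 1 - y i ⬝ᵥ z := by exact_mod_cast hpos
        exact_mod_cast (show (1 : ℤ) ≤ 1 - y i ⬝ᵥ z by omega)
      have heq := (Finset.sum_eq_sum_iff_of_le fun i _ => hle i).1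
        (by rw [(baryBasis hu).sum_coord_apply_eq_one, (baryBasis hu).sum_coord_apply_eq_one])
      apply toReal_injective
      rw [toReal_zero, ← sum_coord_smul hu (toReal z), ← sum_coord_smul hu 0]
      exact Finset.sum_congr rfl fun i hi => by rw [heq i hi]
    · rintro rfl i
      rw [toReal_zero]
      exact pos_of_mul_pos_right ((hβ0 i).symm ▸ one_pos) (hm' i).le
  · convert hull_isLatticePolytope y using 1
    ext x
    rw [hull, mem_dual_convexHull_range, hull, mem_convexHull_range_iff]
    constructor
    · intro hx
      have hsum : ∑ i, (baryBasis hu).coord i 0 * (1 - x ⬝ᵥ toReal (u i)) = 1 := by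
        simp only [mul_sub, mul_one, Finset.sum_sub_distrib, sum_coord_zero_mul_dotProduct hu,
          (baryBasis hu).sum_coord_apply_eq_one, sub_zero]
      refine ⟨fun i => (baryBasis hu).coord i 0 * (1 - x ⬝ᵥ toReal (u i)), ⟨fun i => ?_, hsum⟩, ?_⟩
      · exact mul_nonneg (pos_of_mul_pos_right ((hβ0 i).symm ▸ one_pos) (hm' i).le).le
          (sub_nonneg.2 (hx i))
      · refine eq_of_dotProduct_vertex_eq hu fun j => ?_
        simp only [sum_dotProduct, smul_dotProduct, smul_eq_mul, toReal_dotProduct, h]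
        push_cast
        simp only [mul_sub _ (1 : ℝ) (ite _ _ _), Finset.sum_sub_distrib, mul_one, hsum]
        simp only [mul_ite, mul_zero, Finset.sum_ite_eq', Finset.mem_univ, if_true]
        linear_combination (x ⬝ᵥ toReal (u j) - 1) * hβ0 j
    · rintro ⟨w, ⟨hw0, hw1⟩, rfl⟩ j
      rw [sum_dotProduct, ← hw1]
      refine Finset.sum_le_sum fun i _ => ?_
      rw [smul_dotProduct, smul_eq_mul, toReal_dotProduct, h]
      refine mul_le_of_le_one_right (hw0 i) ?_
      split_ifs
      · push_cast
        linarith [hm' i]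
      · simp

/-- Each facet of a reflexive simplex gives a vertex of the dual. As an extreme point of a lattice
polytope it is a lattice point. -/
theorem exists_facetNormal_of_isReflexive (hu : AffineIndependent ℝ fun i => toReal (u i))
    (h : IsReflexive (hull u)) : ∃ (m : Fin (d + 1) → ℤ) (y : Fin (d + 1) → Fin d → ℤ),
      (∀ i, 0 < m i) ∧ ∀ i j, y i ⬝ᵥ u j = 1 - if i = j then m i else 0 := by
  obtain ⟨-, hint, S, hS⟩ := h
  have hk : ∀ i, 0 < (baryBasis hu).coord i 0 := by
    have := (hint 0).2 rfl
    rwa [hull, interior_convexHull_range hu, toReal_zero] at this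
  set k := fun i => (baryBasis hu).coord i 0 with hkdef
  -- The vertices of the dual simplex.
  let Y : Fin (d + 1) → Fin d → ℝ := fun i =>
    (-(k i)⁻¹) • fun j => baryLinear hu i (Pi.single j 1)
  have hY : ∀ i j, Y i ⬝ᵥ toReal (u j) = 1 - if i = j then (k i)⁻¹ else 0 := by
    intro i j
    have hki : k i ≠ 0 := (hk i).ne'
    have h1 := baryLinear_sub hu i (toReal (u j)) 0
    rw [sub_zero, coord_apply_vertex hu i j] at h1
    simp only [Y, smul_dotProduct, dotProduct_baryLinear_single, h1, smul_eq_mul]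
    change -(k i)⁻¹ * (_ - k i) = _
    have := inv_mul_cancel₀ hki
    split_ifs <;> linarith
  have hext : ∀ i, Y i ∈ (dual (hull u)).extremePoints ℝ := by
    intro i
    have hmem : Y i ∈ dual (hull u) := by
      refine mem_dual_convexHull_range.2 fun j => ?_
      rw [hY]
      have := inv_pos.2 (hk i)
      split_ifs <;> linarith
    -- A point of the dual on the facets through `Y i` is `Y i` itself.
    have huniq : ∀ a : Fin d → ℝ, (∀ j, j ≠ i → a ⬝ᵥ toReal (u j) = 1) → a = Y i := by
      intro a ha
      refine eq_of_dotProduct_vertex_eq hu fun j => ?_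
      have hne : ∀ j, j ≠ i → a ⬝ᵥ toReal (u j) = Y i ⬝ᵥ toReal (u j) := fun j hj => by
        rw [ha j hj, hY, if_neg hj.symm, sub_zero]
      by_cases hj : j = i
      · have h1 := sum_coord_zero_mul_dotProduct hu (a - Y i)
        rw [Finset.sum_eq_single i (fun j _ hj => by
          rw [sub_dotProduct, hne j hj, sub_self, mul_zero]) (by simp), sub_dotProduct] at h1
        rw [hj]
        exact sub_eq_zero.1 ((mul_eq_zero.1 h1).resolve_left (hk i).ne')
      · exact hne j hj
    refine mem_extremePoints.2 ⟨hmem, fun a ha b hb hab => ?_⟩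
    obtain ⟨s, t, hs, ht, hst, hY'⟩ := hab
    have ha' := mem_dual_convexHull_range.1 ha
    have hb' := mem_dual_convexHull_range.1 hb
    have hcomb : ∀ j, j ≠ i → s * (a ⬝ᵥ toReal (u j)) + t * (b ⬝ᵥ toReal (u j)) = 1 := by
      intro j hj
      have := hY i j
      rw [if_neg hj.symm, sub_zero, ← hY', add_dotProduct, smul_dotProduct,
        smul_dotProduct] at this
      exact this
    constructor
    · refine huniq a fun j hj => le_antisymm (ha' j) ?_
      have := hcomb j hj
      have h2 := mul_le_mul_of_nonneg_left (hb' j) ht.le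
      exact le_of_mul_le_mul_left (by linarith) hs
    · refine huniq b fun j hj => le_antisymm (hb' j) ?_
      have := hcomb j hj
      have h2 := mul_le_mul_of_nonneg_left (ha' j) hs.le
      exact le_of_mul_le_mul_left (by linarith) ht
  have hlat : ∀ i, ∃ y : Fin d → ℤ, toReal y = Y i := by
    intro i
    have := hext i
    rw [hS] at this
    obtain ⟨y, -, hy⟩ := extremePoints_convexHull_subset this
    exact ⟨y, hy⟩
  choose y hy using hlat
  have hyY : ∀ i j, ((y i ⬝ᵥ u j : ℤ) : ℝ) = 1 - if i = j then (k i)⁻¹ else 0 := fun i j => by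
    rw [← toReal_dotProduct, hy, hY]
  have hm : ∀ i, ((1 - y i ⬝ᵥ u i : ℤ) : ℝ) = (k i)⁻¹ := fun i => by
    rw [Int.cast_sub, hyY, if_pos rfl, Int.cast_one, sub_sub_cancel]
  refine ⟨fun i => 1 - y i ⬝ᵥ u i, y, fun i => ?_, fun i j => ?_⟩
  · have := inv_pos.2 (hk i)
    rw [← hm] at this
    exact_mod_cast this
  · by_cases hij : i = j
    · subst hij
      simp
    · have := hyY i j
      rw [if_neg hij, sub_zero] at this
      rw [if_neg hij, sub_zero]
      exact_mod_cast this

end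

/-! ### Gorenstein simplices -/

theorem coe_natCast_mul_eq_zero_iff {c : ℕ} {x : ℝ} :
    c • (x : UnitAddCircle) = 0 ↔ ∃ n : ℤ, (c : ℝ) * x = n := by
  rw [← AddCircle.coe_nsmul, nsmul_eq_mul]
  constructor
  · exact exists_intCast_of_coe_eq_zero
  · rintro ⟨n, hn⟩
    rw [hn, coe_intCast]

section

variable {d : ℕ} {v : Fin (d + 1) → Fin d → ℤ}

theorem image_hull (v : Fin (d + 1) → Fin d → ℤ) (r : ℕ) (w : Fin d → ℤ) :
    (fun x => (r : ℝ) • x + toReal w) '' hull v = hull fun i => (r : ℤ) • v i + w := by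
  let f : (Fin d → ℝ) →ᵃ[ℝ] (Fin d → ℝ) :=
    ((r : ℝ) • (LinearMap.id : (Fin d → ℝ) →ₗ[ℝ] _)).toAffineMap + AffineMap.const ℝ _ (toReal w)
  have hf : (fun x => (r : ℝ) • x + toReal w) = f := by
    ext; simp [f]
  rw [hf, hull, AffineMap.image_convexHull, ← Set.range_comp, hull]
  congr 2
  ext1 i
  simp only [toReal_add, toReal_zsmul]
  simp [f]

theorem affineIndependent_smul_add (hv : AffineIndependent ℝ fun i => toReal (v i)) {r : ℕ}
    (hr : 0 < r) (w : Fin d → ℤ) :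
    AffineIndependent ℝ fun i => toReal ((r : ℤ) • v i + w) := by
  let f : (Fin d → ℝ) →ᵃ[ℝ] (Fin d → ℝ) :=
    ((r : ℝ) • (LinearMap.id : (Fin d → ℝ) →ₗ[ℝ] _)).toAffineMap + AffineMap.const ℝ _ (toReal w)
  have hr' : (r : ℝ) ≠ 0 := Nat.cast_ne_zero.2 hr.ne'
  have hf : Function.Injective f := fun x y hxy => by
    simpa [f, hr'] using hxy
  convert hv.map' f hf using 1
  ext1 i
  simp only [toReal_add, toReal_zsmul]
  simp [f]

/-- With `z = ∑ v i / c i`, the polytope `r P - z` is reflexive: since `c i` annihilates the `i`-th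
coordinates, `c i` times the linear part of the `i`-th barycentric coordinate is integral. Its
negative is the vertex of the dual given by the facet opposite to the `i`-th vertex. -/
theorem isGorenstein_of_reciprocal_mem (hv : AffineIndependent ℝ fun i => toReal (v i)) {r : ℕ}
    (hr : 0 < r) {c : Fin (d + 1) → ℕ} (hc : ∀ i, 0 < c i) (hsum : ∑ i, 1 / (c i : ℝ) = r)
    (hmem : (fun i => ((1 / (c i : ℝ) : ℝ) : UnitAddCircle)) ∈ latticeGroup v)
    (hann : ∀ l ∈ latticeGroup v, ∀ i, c i • l i = 0) : IsGorenstein (hull v) r := by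
  obtain ⟨⟨z, hz⟩, -⟩ := (coe_mem_latticeGroup v _).1 hmem
  refine ⟨hull_isLatticePolytope v, hr, -z, ?_⟩
  rw [image_hull]
  have hint : ∀ i j, ∃ n : ℤ, (c i : ℝ) * baryLinear hv i (Pi.single j 1) = n := by
    intro i j
    rw [← coe_natCast_mul_eq_zero_iff]
    have h1 : toReal (Pi.single j 1 : Fin d → ℤ) = Pi.single j 1 := by
      ext k
      by_cases hk : k = j
      · subst hk; simp [toReal]
      · simp [toReal, hk]
    have := hann _ (baryHom_mem hv (Pi.single j 1)) i
    rwa [← h1]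
  choose n hn using hint
  refine isReflexive_of_facetNormal (affineIndependent_smul_add hv hr (-z))
    (m := fun i => r * c i) (y := fun i => -n i)
    (fun i => mul_pos (by exact_mod_cast hr) (by exact_mod_cast hc i)) fun i j => ?_
  have hL : ∀ x : Fin d → ℝ, toReal (-n i) ⬝ᵥ x = -(c i * baryLinear hv i x) := by
    intro x
    have : toReal (-n i) = (-(c i : ℝ)) • fun j => baryLinear hv i (Pi.single j 1) := by
      ext j
      simp [toReal, ← hn]
    rw [this, smul_dotProduct, dotProduct_baryLinear_single, smul_eq_mul, neg_mul]
  have hu : toReal ((r : ℤ) • v j + -z) =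
      ∑ k, ((if j = k then (r : ℝ) else 0) - 1 / (c k : ℝ)) • toReal (v k) := by
    simp only [sub_smul, Finset.sum_sub_distrib, hz]
    simp [toReal_add, sub_eq_add_neg, funext_iff, toReal]
  have hci : (c i : ℝ) ≠ 0 := Nat.cast_ne_zero.2 (hc i).ne'
  rw [← Int.cast_inj (α := ℝ), ← toReal_dotProduct, hL, hu,
    baryLinear_sum_smul hv i (by simp [Finset.sum_sub_distrib, ← hsum])]
  push_cast
  by_cases hij : i = j
  · subst hij
    simp only [if_true]
    field_simp
    ring
  · simp only [if_neg hij, if_neg (Ne.symm hij)]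
    field_simp
    ring

/-- The assumption `0 < d` is needed: a point is Gorenstein of every positive index, as `interior`
and `dual` of the point `ℝ^0` are everything, while its lattice group is trivial. -/
theorem reciprocal_mem_of_isGorenstein (hv : AffineIndependent ℝ fun i => toReal (v i))
    (hd : 0 < d) {r : ℕ} (h : IsGorenstein (hull v) r) :
    ∃ c : Fin (d + 1) → ℕ, (∀ i, 0 < c i) ∧ ∑ i, 1 / (c i : ℝ) = r ∧
      (fun i => ((1 / (c i : ℝ) : ℝ) : UnitAddCircle)) ∈ latticeGroup v ∧
      ∀ l ∈ latticeGroup v, ∀ i, c i • l i = 0 := by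
  obtain ⟨-, hr, w, hw⟩ := h
  rw [image_hull] at hw
  have hu := affineIndependent_smul_add hv hr w
  obtain ⟨m, y, hm, hy⟩ := exists_facetNormal_of_isReflexive hu hw
  have hrz : (0 : ℤ) < r := by exact_mod_cast hr
  have hr' : (r : ℝ) ≠ 0 := Nat.cast_ne_zero.2 hr.ne'
  have hmR : ∀ i, (m i : ℝ) ≠ 0 := fun i => Int.cast_ne_zero.2 (hm i).ne'
  -- As `y i` takes the value `1` on another vertex, `1 - y i ⬝ᵥ w` is a multiple of `r`.
  have hdvd : ∀ i, ∃ t : ℤ, 1 - y i ⬝ᵥ w = r * t := by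
    intro i
    have : Nontrivial (Fin (d + 1)) := Fin.nontrivial_iff_two_le.2 (by omega)
    obtain ⟨j, hj⟩ := exists_ne i
    refine ⟨y i ⬝ᵥ v j, ?_⟩
    have := hy i j
    rw [if_neg hj.symm, dotProduct_add, dotProduct_smul, smul_eq_mul] at this
    linarith
  choose t ht using hdvd
  have hc : ∀ i, ∃ c : ℕ, 0 < c ∧ m i = r * c := by
    intro i
    have h1 := hy i i
    rw [if_pos rfl, dotProduct_add, dotProduct_smul, smul_eq_mul] at h1
    have h2 : m i = r * (t i - y i ⬝ᵥ v i) := by linarith [ht i]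
    have h3 : 0 < t i - y i ⬝ᵥ v i := pos_of_mul_pos_right (h2 ▸ hm i) hrz.le
    exact ⟨(t i - y i ⬝ᵥ v i).toNat, by omega, by rw [Int.toNat_of_nonneg h3.le, h2]⟩
  choose c hc0 hmc using hc
  have hcR : ∀ i, (c i : ℝ) ≠ 0 := fun i => Nat.cast_ne_zero.2 (hc0 i).ne'
  have hβ : ∀ i, (baryBasis hu).coord i 0 = 1 / (m i : ℝ) := fun i => by
    have := mul_coord_of_facetNormal hu hy i 0
    rw [dotProduct_zero, sub_zero] at this
    rw [eq_div_iff (hmR i), mul_comm, this]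
  have hrc : ∀ i, 1 / (c i : ℝ) = r * (1 / (m i : ℝ)) := fun i => by
    rw [hmc]
    push_cast
    have := hcR i
    field_simp
  have hsum : ∑ i, 1 / (c i : ℝ) = r := by
    have := (baryBasis hu).sum_coord_apply_eq_one 0
    simp only [hβ] at this
    simp only [hrc, ← Finset.mul_sum, this, mul_one]
  refine ⟨c, hc0, hsum, ?_, ?_⟩
  · refine (coe_mem_latticeGroup v _).2 ⟨⟨-w, ?_⟩, r, by rw [hsum]; simp⟩
    have h0 := sum_coord_smul hu 0
    simp only [hβ] at h0
    simp only [toReal_add, toReal_zsmul, smul_add, Finset.sum_add_distrib, smul_smul,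
      ← Finset.sum_smul] at h0
    have h1 := (baryBasis hu).sum_coord_apply_eq_one 0
    simp only [hβ] at h1
    rw [h1, one_smul] at h0
    simp only [hrc]
    have h2 : toReal (-w) = -toReal w := by ext; simp [toReal]
    rw [h2, ← eq_neg_of_add_eq_zero_left h0]
    refine Finset.sum_congr rfl fun i _ => ?_
    rw [mul_comm]
    simp
  · intro l hl i
    choose x hx using fun i => QuotientAddGroup.mk_surjective (l i)
    obtain rfl : (fun i => (x i : UnitAddCircle)) = l := funext hx
    obtain ⟨⟨z, hz⟩, s, hs⟩ := (coe_mem_latticeGroup v x).1 hl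
    change c i • (x i : UnitAddCircle) = 0
    refine coe_natCast_mul_eq_zero_iff.2 ⟨s * t i - y i ⬝ᵥ z, ?_⟩
    -- Evaluate `y i` on `∑ j, x j • u j = r • z + s • w`, where `u j` are the dilated vertices.
    have h1 : toReal (y i) ⬝ᵥ ∑ j, x j • toReal ((r : ℤ) • v j + w) = s - m i * x i := by
      simp only [dotProduct_sum, dotProduct_smul, toReal_dotProduct, hy, smul_eq_mul]
      push_cast
      simp [mul_sub, Finset.sum_sub_distrib, hs, mul_comm]
    have h2 : ∑ j, x j • toReal ((r : ℤ) • v j + w) = toReal ((r : ℤ) • z + s • w) := by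
      simp only [toReal_add, toReal_zsmul, smul_add, Finset.sum_add_distrib, ← hz, ← hs,
        ← Finset.sum_smul, Finset.smul_sum, smul_smul, mul_comm]
    rw [h2, toReal_dotProduct, dotProduct_add, dotProduct_smul, dotProduct_smul, smul_eq_mul,
      smul_eq_mul] at h1
    have h3 : (1 : ℝ) - ((y i ⬝ᵥ w : ℤ) : ℝ) = r * t i := by exact_mod_cast ht i
    have h4 : (m i : ℝ) = r * c i := by exact_mod_cast hmc i
    rw [h4] at h1
    push_cast at h1 ⊢
    apply mul_left_cancel₀ hr'
    linear_combination s * h3 + h1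

end

/-! ### Lattice pyramids -/

theorem convexHull_insert_convexHull {E : Type*} [AddCommGroup E] [Module ℝ E] (a : E) (s : Set E) :
    convexHull ℝ (insert a (convexHull ℝ s)) = convexHull ℝ (insert a s) := by
  refine subset_antisymm (convexHull_min ?_ (convex_convexHull ℝ _))
    (convexHull_mono (Set.insert_subset_insert (subset_convexHull ℝ s)))
  exact Set.insert_subset (subset_convexHull ℝ _ (Set.mem_insert _ _))
    (convexHull_mono (Set.subset_insert _ _))

/-- The linear map `x ↦ (x, 0)`. -/
def snocZero (e : ℕ) : (Fin e → ℝ) →ₗ[ℝ] (Fin (e + 1) → ℝ) where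
  toFun x := Fin.snoc x 0
  map_add' x y := by
    ext j
    refine Fin.lastCases ?_ (fun k => ?_) j <;> simp
  map_smul' c x := by
    ext j
    refine Fin.lastCases ?_ (fun k => ?_) j <;> simp

theorem pyramid_hull {e n : ℕ} (u : Fin (n + 1) → Fin e → ℤ) :
    pyramid (hull u) = convexHull ℝ (insert (Pi.single (Fin.last e) 1)
      (Set.range fun i => snocZero e (toReal (u i)))) := by
  rw [pyramid, hull]
  change convexHull ℝ (insert _ (snocZero e '' _)) = _
  rw [LinearMap.image_convexHull, convexHull_insert_convexHull, ← Set.range_comp]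
  rfl

/-- If the `i`-th coordinates vanish, the `i`-th barycentric coordinate has an integral linear part
`F` on the lattice. A basis of its kernel, completed by an edge to the apex `v i`, on which `F` is
`1`, is the unimodular matrix that makes the simplex a pyramid. -/
theorem isLatticePyramid_of_coordinate_eq_zero {e : ℕ} {v : Fin (e + 1 + 1) → Fin (e + 1) → ℤ}
    (hv : AffineIndependent ℝ fun i => toReal (v i)) (i : Fin (e + 1 + 1))
    (hi : ∀ l ∈ latticeGroup v, l i = 0) : IsLatticePyramid (hull v) := by
  have hint : ∀ z : Fin (e + 1) → ℤ, ∃ n : ℤ, baryLinear hv i (toReal z) = n := fun z =>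
    exists_intCast_of_coe_eq_zero (hi _ (baryHom_mem hv z))
  choose f hf using hint
  let F : (Fin (e + 1) → ℤ) →ₗ[ℤ] ℤ := AddMonoidHom.toIntLinearMap
    { toFun := f
      map_zero' := by
        rw [← Int.cast_inj (α := ℝ), ← hf, toReal_zero, map_zero, Int.cast_zero]
      map_add' := fun x y => by
        rw [← Int.cast_inj (α := ℝ), Int.cast_add, ← hf, ← hf, ← hf, toReal_add, map_add] }
  have hF : ∀ j k, F (v j - v k) = (if i = j then 1 else 0) - if i = k then 1 else 0 := by
    intro j k
    change f (v j - v k) = _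
    rw [← Int.cast_inj (α := ℝ), ← hf, toReal_sub, baryLinear_sub,
      coord_apply_vertex hv i j, coord_apply_vertex hv i k]
    push_cast
    rfl
  -- The lattice splits as the kernel of `F` and the edge from the base to the apex `v i`.
  let w := v (i.succAbove 0)
  have hFa : F (v i - w) = 1 := by
    simp [w, hF, (Fin.succAbove_ne i 0).symm]
  obtain ⟨n, ⟨b⟩⟩ : ∃ n : ℕ, Nonempty (Module.Basis (Fin n) ℤ (LinearMap.ker F)) :=
    ⟨_, ⟨Module.finBasis ℤ (LinearMap.ker F)⟩⟩
  let B := Module.Basis.mkFinSnoc b (v i - w)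
    (fun c x hx hc => by
      have := congrArg F hc
      rw [map_add, map_smul, hFa, LinearMap.mem_ker.1 hx] at this
      simpa using this)
    (fun z => ⟨-F z, by
      rw [LinearMap.mem_ker, map_add, map_smul, hFa]
      simp⟩)
  obtain rfl : n = e := by
    have h1 := Module.finrank_eq_card_basis B
    simp only [Module.finrank_fintype_fun_eq_card, Fintype.card_fin] at h1
    omega
  have hB : (B : Fin (n + 1) → Fin (n + 1) → ℤ) = Fin.snoc (Subtype.val ∘ b) (v i - w) :=
    Module.Basis.coe_mkFinSnoc _ _ _ _
  let U : Matrix (Fin (n + 1)) (Fin (n + 1)) ℤ := Matrix.of B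
  have hU : U.det = 1 ∨ U.det = -1 := by
    have h := (Pi.basisFun ℤ (Fin (n + 1))).isUnit_det B
    rw [Pi.basisFun_det_apply] at h
    exact Int.isUnit_iff.1 h
  have hbase : ∀ j, v (i.succAbove j) - w ∈ LinearMap.ker F := fun j => by
    rw [LinearMap.mem_ker, hF]
    simp [(Fin.succAbove_ne i _).symm]
  let u : Fin (n + 1) → Fin n → ℤ := fun j => b.equivFun ⟨_, hbase j⟩
  let f' : (Fin (n + 1) → ℝ) →ᵃ[ℝ] (Fin (n + 1) → ℝ) :=
    (Matrix.vecMulLinear (U.map fun a : ℤ => (a : ℝ))).toAffineMap +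
      AffineMap.const ℝ _ (toReal w)
  have hf' : ∀ x, f' x = Matrix.vecMul x (U.map fun a : ℤ => (a : ℝ)) + toReal w := fun x => by
    simp [f']
  have hvec : ∀ x : Fin (n + 1) → ℝ, Matrix.vecMul x (U.map fun a : ℤ => (a : ℝ)) =
      ∑ k, x k • toReal (B k) := fun x => by
    rw [Matrix.vecMul_eq_sum]
    rfl
  have hapex : f' (Pi.single (Fin.last n) 1) = toReal (v i) := by
    rw [hf', hvec, Fin.sum_univ_castSucc]
    simp [hB, toReal_sub]
  have hfu : ∀ j, f' (snocZero n (toReal (u j))) = toReal (v (i.succAbove j)) := by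
    intro j
    have h1 := b.sum_equivFun ⟨_, hbase j⟩
    have h2 := congrArg (fun z => toReal (LinearMap.ker F |>.subtype z)) h1
    simp only [map_sum, map_smul, toReal_sum, toReal_zsmul, Submodule.subtype_apply,
      toReal_sub] at h2
    rw [hf', hvec, Fin.sum_univ_castSucc, ← eq_sub_iff_add_eq, ← h2]
    simp [snocZero, hB, toReal, u]
  refine ⟨u, ?_, U, w, hU, ?_⟩
  · refine AffineIndependent.of_comp (f'.comp (snocZero n).toAffineMap) ?_
    convert hv.comp_embedding i.succAboveEmb using 1
    ext1 j
    exact hfu j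
  · rw [pyramid_hull, ← funext hf', AffineMap.image_convexHull, Set.image_insert_eq,
      ← Set.range_comp, hapex, hull]
    congr 1
    ext x
    simp only [Set.mem_insert_iff, Set.mem_range, Function.comp_apply, hfu]
    rw [Fin.exists_iff_succAbove i, eq_comm]

/-! ### Groups of order `p * q` -/

theorem eq_of_dvd_prime_mul_prime {p q k : ℕ} (hp : p.Prime) (hq : q.Prime) (h : k ∣ p * q) :
    k = 1 ∨ k = p ∨ k = q ∨ k = p * q := by
  obtain ⟨a, b, ha, hb, rfl⟩ := (Nat.dvd_mul).1 h
  rcases (Nat.dvd_prime hp).1 ha with rfl | rfl <;> rcases (Nat.dvd_prime hq).1 hb with rfl | rfl <;>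
    simp

theorem nsmul_coe_reciprocal_eq_zero_iff {c n : ℕ} (hc : 0 < c) :
    n • ((1 / (c : ℝ) : ℝ) : UnitAddCircle) = 0 ↔ c ∣ n := by
  rw [← addOrderOf_dvd_iff_nsmul_eq_zero, AddCircle.addOrderOf_period_div hc]

/-- The first `s₁` entries are `a`, the next `s₂` entries are `b`, the remaining ones are `c`. -/
def threeBlock {α : Type*} (s₁ s₂ : ℕ) (a b c : α) (i : ℕ) : α :=
  if i < s₁ then a else if i < s₁ + s₂ then b else c

theorem sum_threeBlock {n s₁ s₂ s₃ : ℕ} (h : s₁ + s₂ + s₃ = n) (a b c : ℝ) :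
    ∑ i : Fin n, threeBlock s₁ s₂ a b c i = s₁ * a + s₂ * b + s₃ * c := by
  subst h
  rw [Fin.sum_univ_add, Fin.sum_univ_add]
  simp [threeBlock, add_assoc]

theorem apply_threeBlock {α β : Type*} (f : α → β) (s₁ s₂ : ℕ) (a b c : α) (i : ℕ) :
    f (threeBlock s₁ s₂ a b c i) = threeBlock s₁ s₂ (f a) (f b) (f c) i := by
  unfold threeBlock
  split_ifs <;> rfl

theorem generator_eq (n p q s₁ s₂ : ℕ) : generator n p q s₁ s₂ = fun i : Fin (n + 1) =>
    ((1 / (threeBlock s₁ s₂ p q (p * q) (i : ℕ) : ℕ) : ℝ) : UnitAddCircle) := by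
  ext1 i
  rw [generator, threeBlock]
  split_ifs <;> simp

/-- A family with three values can be sorted into blocks. -/
theorem exists_perm_eq_threeBlock {α : Type*} {n : ℕ} {a b c : α} (f : Fin n → α)
    (h : ∀ i, f i = a ∨ f i = b ∨ f i = c) : ∃ (s₁ s₂ s₃ : ℕ) (σ : Equiv.Perm (Fin n)),
      s₁ + s₂ + s₃ = n ∧ ∀ i, f (σ i) = threeBlock s₁ s₂ a b c i := by
  classical
  -- Sort by the rank `k` of the value; in a sorted family the entries of rank at most `t` come first.
  let k : Fin n → Fin 3 := fun i => if f i = a then 0 else if f i = b then 1 else 2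
  let σ := Tuple.sort k
  have hmono : Monotone (k ∘ σ) := Tuple.monotone_sort k
  let N : Fin 3 → ℕ := fun t => (Finset.univ.filter fun i => (k ∘ σ) i ≤ t).card
  have hN : ∀ t (i : Fin n), (i : ℕ) < N t ↔ k (σ i) ≤ t := fun t i =>
    Tuple.lt_card_le_iff_apply_le_of_monotone hmono
  have h01 : N 0 ≤ N 1 := Finset.card_le_card fun i hi => by
    rw [Finset.mem_filter_univ] at hi ⊢
    exact hi.trans (by decide)
  have h1n : N 1 ≤ n := by
    exact (Finset.card_le_univ _).trans_eq (Fintype.card_fin n)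
  refine ⟨N 0, N 1 - N 0, n - N 1, σ, by omega, fun i => ?_⟩
  rw [threeBlock, Nat.add_sub_cancel' h01]
  simp only [hN, k]
  rcases h (σ i) with h | h | h <;> split_ifs <;> simp_all

theorem comp_perm_mem_latticeGroup_iff {d n : ℕ} {v : Fin (n + 1) → Fin d → ℤ}
    {l : Fin (n + 1) → UnitAddCircle} (σ : Equiv.Perm (Fin (n + 1))) :
    (fun i => l (σ i)) ∈ latticeGroup (fun i => v (σ i)) ↔ l ∈ latticeGroup v := by
  change ((∀ j, ∑ i, v (σ i) j • l (σ i) = 0) ∧ ∑ i, l (σ i) = 0) ↔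
    ((∀ j, ∑ i, v i j • l i = 0) ∧ ∑ i, l i = 0)
  simp only [Equiv.sum_comp σ l, fun j => Equiv.sum_comp σ fun i => v i j • l i]

theorem latticeGroup_comp_perm {d n : ℕ} {v : Fin (n + 1) → Fin d → ℤ}
    {g : Fin (n + 1) → UnitAddCircle} (h : latticeGroup v = AddSubgroup.zmultiples g)
    (σ : Equiv.Perm (Fin (n + 1))) :
    latticeGroup (fun i => v (σ i)) = AddSubgroup.zmultiples fun i => g (σ i) := by
  ext l
  have hl : l = fun i => l (σ.symm (σ i)) := by simp
  rw [hl, comp_perm_mem_latticeGroup_iff (l := fun i => l (σ.symm i)) σ, h,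
    AddSubgroup.mem_zmultiples_iff, AddSubgroup.mem_zmultiples_iff]
  refine exists_congr fun k => ?_
  rw [funext_iff, funext_iff, ← σ.forall_congr_right]
  rfl

theorem hull_comp_perm {d n : ℕ} (v : Fin (n + 1) → Fin d → ℤ) (σ : Equiv.Perm (Fin (n + 1))) :
    hull (fun i => v (σ i)) = hull v :=
  congrArg (convexHull ℝ) (σ.surjective.range_comp fun i => toReal (v i))

/-- If the exponents `c i` annihilate the coordinates of a group of order `p * q`, then an element
`(1 / c i)` of the group generates it: its order is divisible by each `c i`, hence annihilates the
group, hence is divisible by `p` and `q` by Cauchy's theorem. -/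
theorem eq_zmultiples_of_reciprocal_mem {ι : Type*} {p q : ℕ} (hp : p.Prime) (hq : q.Prime)
    (hpq : p ≠ q) {G : AddSubgroup (ι → UnitAddCircle)} (hcard : Nat.card G = p * q)
    {c : ι → ℕ} (hc : ∀ i, 0 < c i)
    (hmem : (fun i => ((1 / (c i : ℝ) : ℝ) : UnitAddCircle)) ∈ G)
    (hann : ∀ l ∈ G, ∀ i, c i • l i = 0) :
    G = AddSubgroup.zmultiples fun i => ((1 / (c i : ℝ) : ℝ) : UnitAddCircle) := by
  have hfin : Finite G := Nat.finite_of_card_ne_zero (hcard ▸ mul_ne_zero hp.ne_zero hq.ne_zero)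
  set g : ι → UnitAddCircle := fun i => ((1 / (c i : ℝ) : ℝ) : UnitAddCircle) with hg
  have hcn : ∀ i, c i ∣ addOrderOf g := fun i =>
    (nsmul_coe_reciprocal_eq_zero_iff (hc i)).1 (congrFun (addOrderOf_nsmul_eq_zero g) i)
  have hprime : ∀ ℓ : ℕ, ℓ.Prime → ℓ ∣ p * q → ℓ ∣ addOrderOf g := by
    intro ℓ hℓ hdvd
    have : Fact ℓ.Prime := ⟨hℓ⟩
    obtain ⟨x, hx⟩ := exists_prime_addOrderOf_dvd_card' ℓ (hcard ▸ hdvd : ℓ ∣ Nat.card G)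
    rw [← hx]
    refine addOrderOf_dvd_iff_nsmul_eq_zero.2 (Subtype.ext (funext fun i => ?_))
    obtain ⟨m, hm⟩ := hcn i
    change addOrderOf g • (x : ι → UnitAddCircle) i = 0
    rw [hm, mul_comm, mul_nsmul', hann _ x.2, nsmul_zero]
  have hdvd : p * q ∣ addOrderOf g :=
    ((Nat.coprime_primes hp hq).2 hpq).mul_dvd_of_dvd_of_dvd (hprime p hp (dvd_mul_right _ _))
      (hprime q hq (dvd_mul_left _ _))
  have hle : AddSubgroup.zmultiples g ≤ G := AddSubgroup.zmultiples_le_of_mem hmem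
  have hcle := AddSubgroup.card_dvd_of_le hle
  refine (AddSubgroup.eq_of_le_of_card_ge hle ?_).symm
  rw [hcard]
  refine Nat.le_of_dvd (Nat.pos_of_dvd_of_pos hcle Nat.card_pos) ?_
  rwa [Nat.card_zmultiples]

end GorensteinSimplex

open GorensteinSimplex

theorem theorem0p3 (p q : ℕ) (hp : p.Prime) (hq : q.Prime) (hpq : p ≠ q)
    (d : ℕ) (v : Fin (d + 1) → Fin d → ℤ) (hv : IsSimplex v)
    (hvol : normalizedVolume (hull v) = (p : ℝ) * (q : ℝ))
    (hpyr : ¬ IsLatticePyramid (hull v)) (r : ℕ) :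
    IsGorenstein (hull v) r ↔
      ∃ s₁ s₂ s₃ : ℕ, s₁ + s₂ + s₃ = d + 1 ∧
        r * (p * q) = s₁ * q + s₂ * p + s₃ ∧
        ∃ σ : Equiv.Perm (Fin (d + 1)),
          latticeGroup (fun i => v (σ i)) = AddSubgroup.zmultiples (generator d p q s₁ s₂) := by
  have hp0 : (p : ℝ) ≠ 0 := Nat.cast_ne_zero.2 hp.ne_zero
  have hq0 : (q : ℝ) ≠ 0 := Nat.cast_ne_zero.2 hq.ne_zero
  have hv' : AffineIndependent ℝ fun i => toReal (v i) := hv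
  have hdet : (edges v).det.natAbs = p * q := by
    rw [normalizedVolume_hull] at hvol
    exact_mod_cast hvol
  have hcard : Nat.card (latticeGroup v) = p * q := by rw [card_latticeGroup hv', hdet]
  obtain ⟨e, rfl⟩ : ∃ e, d = e + 1 := by
    refine Nat.exists_eq_succ_of_ne_zero ?_
    rintro rfl
    rw [Matrix.det_fin_zero, Int.natAbs_one] at hdet
    exact hp.one_lt.ne' (Nat.eq_one_of_mul_eq_one_right hdet.symm)
  have hsum : ∀ {s₁ s₂ s₃ : ℕ}, s₁ + s₂ + s₃ = e + 1 + 1 →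
      (∑ i : Fin (e + 1 + 1), 1 / ((threeBlock s₁ s₂ p q (p * q) i : ℕ) : ℝ) = r ↔
        r * (p * q) = s₁ * q + s₂ * p + s₃) := by
    intro s₁ s₂ s₃ h
    simp only [apply_threeBlock (fun c : ℕ => 1 / (c : ℝ)), sum_threeBlock h]
    rw [← Nat.cast_inj (R := ℝ)]
    push_cast
    field_simp
    constructor <;> intro h <;> linarith
  constructor
  · intro hG
    obtain ⟨c, hc, hcsum, hmem, hann⟩ := reciprocal_mem_of_isGorenstein hv' e.succ_pos hG
    have hval : ∀ i, c i = p ∨ c i = q ∨ c i = p * q := by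
      intro i
      have h1 : (p * q) • ((1 / (c i : ℝ) : ℝ) : UnitAddCircle) = 0 := by
        have := card_nsmul_eq_zero' (x := (⟨_, hmem⟩ : latticeGroup v))
        rw [hcard] at this
        exact congrFun (congrArg Subtype.val this) i
      refine (eq_of_dvd_prime_mul_prime hp hq
        ((nsmul_coe_reciprocal_eq_zero_iff (hc i)).1 h1)).resolve_left fun h2 => hpyr ?_
      refine isLatticePyramid_of_coordinate_eq_zero hv' i fun l hl => ?_
      simpa [h2] using hann l hl i
    obtain ⟨s₁, s₂, s₃, σ, hs, hσ⟩ := exists_perm_eq_threeBlock c hval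
    refine ⟨s₁, s₂, s₃, hs, (hsum hs).1 ?_, σ, ?_⟩
    · simp only [← hσ]
      rw [Equiv.sum_comp σ fun i => 1 / (c i : ℝ), hcsum]
    · rw [latticeGroup_comp_perm (eq_zmultiples_of_reciprocal_mem hp hq hpq hcard hc hmem hann) σ,
        generator_eq]
      simp only [hσ]
  · rintro ⟨s₁, s₂, s₃, hs, hr, σ, hσ⟩
    have hr0 : 0 < r := by
      refine Nat.pos_of_ne_zero ?_
      rintro rfl
      have hp1 := hp.pos
      have hq1 := hq.pos
      have h1 : s₁ * q = 0 := by omega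
      have h2 : s₂ * p = 0 := by omega
      rcases Nat.mul_eq_zero.1 h1 with h1 | h1 <;> rcases Nat.mul_eq_zero.1 h2 with h2 | h2 <;>
        omega
    have hc : ∀ i : ℕ, 0 < threeBlock s₁ s₂ p q (p * q) i := by
      intro i
      rw [threeBlock]
      split_ifs
      exacts [hp.pos, hq.pos, mul_pos hp.pos hq.pos]
    rw [generator_eq] at hσ
    rw [← hull_comp_perm v σ]
    refine isGorenstein_of_reciprocal_mem (v := fun i => v (σ i)) (hv'.comp_embedding σ.toEmbedding) hr0
      (c := fun i => threeBlock s₁ s₂ p q (p * q) i) (fun i => hc i) ((hsum hs).2 hr) ?_ ?_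
    · rw [hσ]
      exact AddSubgroup.mem_zmultiples _
    · intro l hl i
      rw [hσ] at hl
      obtain ⟨k, rfl⟩ := AddSubgroup.mem_zmultiples_iff.1 hl
      rw [Pi.smul_apply, smul_comm, (nsmul_coe_reciprocal_eq_zero_iff (hc i)).2 dvd_rfl, smul_zero]
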